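/- Let $G$ be a locally compact group with left Haar measure $dg$, and let $V$ be a complex Hilbert space with inner product $\langle\cdot,\cdot\rangle$ linear in the first argument and conjugate-linear in the second. Call a vector $f\in V$ an admissible mother wavelet for a unitary representation $\pi$ of $G$ on $V$ if $$0<\int_G|\langle f,\pi(g)f\rangle|^2\,dg<\infty .$$ Call $\pi$ square integrable if it is a strongly continuous, (topologically) irreducible unitary representation that has at least one admissible mother wavelet. (Orthogonality relation.) Let $\pi$ be a square integrable representation of $G$ on $V$. Then for any two admissible mother wavelets $f,f'\in V$ there is a constant $c=c(f',f)\in\mathbb{C}$ such that, for all $v,v'\in V$, the function $g\mapsto\langle v,\pi(g)f\rangle\,\overline{\langle v',\pi(g)f'\rangle}$ is integrable on $G$ and $$\int_G\langle v,\pi(g)f\rangle\,\overline{\langle v',\pi(g)f'\rangle}\,dg=c(f',f)\,\langle v,v'\rangle .$$ Moreover, the admissible mother wavelets together with $0$ form a linear subspace $\mathcal{A}$ of $V$, and $c$ (with $c(f',f)=0$ if $f=0$ or $f'=0$) is a sesquilinear form on $\mathcal{A}$, linear in $f'$ and conjugate-linear in $f$. -/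

import Mathlib

open MeasureTheory

/-- The paper's inner product: linear in the first argument, conjugate-linear in the second. -/
noncomputable def scalar {V : Type*} [NormedAddCommGroup V] [InnerProductSpace ℂ V]
    (v w : V) : ℂ :=
  inner ℂ w v

section UnitaryRepresentations

variable {G V : Type*} [Group G] [NormedAddCommGroup V] [InnerProductSpace ℂ V]

/-- Strong continuity of a unitary representation. -/
def IsStronglyContinuous [TopologicalSpace G] (π : G →* (V ≃ₗᵢ[ℂ] V)) : Prop :=
  ∀ v : V, Continuous fun g : G => π g v

/-- Topological irreducibility: the space is nonzero and its only closed invariant subspaces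
are `0` and the whole space. -/
def IsTopIrreducible (π : G →* (V ≃ₗᵢ[ℂ] V)) : Prop :=
  Nontrivial V ∧ ∀ W : Submodule ℂ V, IsClosed (W : Set V) →
    (∀ g : G, ∀ w ∈ W, π g w ∈ W) → W = ⊥ ∨ W = ⊤

/-- The wavelet transform `g ↦ ⟨v, π(g) f⟩` of `v` with mother wavelet `f`. -/
noncomputable def waveletTransform (π : G →* (V ≃ₗᵢ[ℂ] V)) (f v : V) (g : G) : ℂ :=
  scalar v (π g f)

/-- Admissibility of a mother wavelet: `0 < ∫ |⟨f, π(g) f⟩|² dg < ∞`. -/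
def IsAdmissible [MeasurableSpace G] (π : G →* (V ≃ₗᵢ[ℂ] V)) (μ : Measure G) (f : V) : Prop :=
  0 < ∫⁻ g, ‖waveletTransform π f f g‖ₑ ^ 2 ∂μ ∧ ∫⁻ g, ‖waveletTransform π f f g‖ₑ ^ 2 ∂μ < ⊤

/-- A square integrable representation: a strongly continuous irreducible unitary representation
that has an admissible vector. -/
structure IsSquareIntegrableRep [TopologicalSpace G] [MeasurableSpace G]
    (π : G →* (V ≃ₗᵢ[ℂ] V)) (μ : Measure G) : Prop where
  continuous : IsStronglyContinuous π
  irreducible : IsTopIrreducible π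
  exists_admissible : ∃ f : V, IsAdmissible π μ f

end UnitaryRepresentations

section Schur

variable {G V : Type*} [Group G] [NormedAddCommGroup V] [InnerProductSpace ℂ V]

theorem inner_unitary_left (π : G →* (V ≃ₗᵢ[ℂ] V)) (g : G) (v w : V) :
    inner ℂ (π g v) w = inner ℂ v (π g⁻¹ w) := by
  rw [← (π g).inner_map_map v, map_inv]
  exact congrArg _ ((π g).apply_symm_apply w).symm

theorem IsTopIrreducible.mul_ne_zero {π : G →* (V ≃ₗᵢ[ℂ] V)} (hπ : IsTopIrreducible π)
    {S T : V →L[ℂ] V} (hS : ∀ g v, S (π g v) = π g (S v)) (hS0 : S ≠ 0) (hT0 : T ≠ 0) :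
    S * T ≠ 0 := by
  intro h
  have hker := hπ.2 S.ker S.isClosed_ker fun g w hw => by
    have hw' : S w = 0 := hw
    change S (π g w) = 0
    rw [hS, hw', map_zero]
  rcases hker with hbot | htop
  · refine hT0 (ContinuousLinearMap.ext fun v => ?_)
    have : T v ∈ S.ker := congrArg (fun A : V →L[ℂ] V => A v) h
    rw [hbot] at this
    exact this
  · refine hS0 (ContinuousLinearMap.ext fun v => ?_)
    have : v ∈ S.ker := htop ▸ Submodule.mem_top
    exact this

variable [CompleteSpace V]

theorem ContinuousLinearMap.adjoint_comm_unitary {π : G →* (V ≃ₗᵢ[ℂ] V)} {T : V →L[ℂ] V}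
    (hT : ∀ g v, T (π g v) = π g (T v)) (g : G) (v : V) :
    ContinuousLinearMap.adjoint T (π g v) = π g (ContinuousLinearMap.adjoint T v) := by
  refine ext_inner_right ℂ fun w => ?_
  rw [ContinuousLinearMap.adjoint_inner_left, inner_unitary_left, inner_unitary_left, ContinuousLinearMap.adjoint_inner_left, hT]

theorem IsTopIrreducible.exists_eq_smul_of_isSelfAdjoint {π : G →* (V ≃ₗᵢ[ℂ] V)}
    (hπ : IsTopIrreducible π) {T : V →L[ℂ] V} (hsa : IsSelfAdjoint T)
    (hT : ∀ g v, T (π g v) = π g (T v)) : ∃ a : ℂ, T = a • 1 := by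
  by_cases hs : (spectrum ℝ T).Subsingleton
  · obtain ⟨a, ha⟩ : ∃ a : ℝ, ∀ x ∈ spectrum ℝ T, x = a := by
      rcases hs.eq_empty_or_singleton with h | ⟨a, h⟩
      · exact ⟨0, by simp [h]⟩
      · exact ⟨a, by simp [h]⟩
    refine ⟨a, ?_⟩
    have h : cfc (id : ℝ → ℝ) T = cfc (fun _ => a) T := cfc_congr ha
    rw [cfc_id ℝ T, cfc_const a T, Algebra.algebraMap_eq_smul_one] at h
    rw [h]
    exact (Complex.coe_smul a 1).symm
  · rw [Set.not_subsingleton_iff] at hs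
    obtain ⟨a, ha, b, hb, hab⟩ := hs.exists_lt
    set m := (a + b) / 2
    have hcomm : ∀ (f : ℝ → ℝ) (g : G) (v : V), cfc f T (π g v) = π g (cfc f T v) := fun f g v => by
      have hc : Commute T ((π g).toContinuousLinearEquiv : V →L[ℂ] V) :=
        ContinuousLinearMap.ext fun v => hT g v
      exact congrArg (fun A : V →L[ℂ] V => A v) (hsa.commute_cfc hc f).eq
    have hne : ∀ f : ℝ → ℝ, Continuous f → ∀ x ∈ spectrum ℝ T, f x ≠ 0 → cfc f T ≠ 0 := by
      intro f hf x hx hfx h0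
      rw [← cfc_const_zero ℝ T] at h0
      exact hfx (eqOn_of_cfc_eq_cfc h0 hf.continuousOn continuousOn_const hsa hx)
    refine absurd ?_ (hπ.mul_ne_zero (hcomm fun t => max (t - m) 0)
      (hne _ (by fun_prop) b hb (by simp only [m]; exact (lt_max_of_lt_left (by linarith)).ne'))
      (hne (fun t => max (m - t) 0) (by fun_prop) a ha
        (by simp only [m]; exact (lt_max_of_lt_left (by linarith)).ne')))
    rw [← cfc_mul _ _ T (by fun_prop) (by fun_prop), ← cfc_const_zero ℝ T]
    congr 1
    funext t
    rcases le_total t m with h | h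
    · rw [max_eq_right (by linarith : t - m ≤ 0), zero_mul]
    · rw [max_eq_right (by linarith : m - t ≤ 0), mul_zero]

/-- **Schur's lemma** for topologically irreducible unitary representations. -/
theorem IsTopIrreducible.exists_eq_smul {π : G →* (V ≃ₗᵢ[ℂ] V)}
    (hπ : IsTopIrreducible π) {T : V →L[ℂ] V}
    (hT : ∀ g v, T (π g v) = π g (T v)) : ∃ a : ℂ, T = a • 1 := by
  have hT' := ContinuousLinearMap.adjoint_comm_unitary hT
  obtain ⟨a, ha⟩ := hπ.exists_eq_smul_of_isSelfAdjoint (realPart T).2 fun g v => by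
    simp [realPart_apply_coe, ContinuousLinearMap.star_eq_adjoint, hT, hT',
      map_real_smul (π g) (π g).continuous]
  obtain ⟨b, hb⟩ := hπ.exists_eq_smul_of_isSelfAdjoint (imaginaryPart T).2 fun g v => by
    simp [imaginaryPart_apply_coe, ContinuousLinearMap.star_eq_adjoint, hT, hT',
      map_real_smul (π g) (π g).continuous, smul_sub]
  refine ⟨a + Complex.I * b, ?_⟩
  rw [← realPart_add_I_smul_imaginaryPart T, ha, hb, smul_smul, add_smul]

end Schur

section WaveletTransform

variable {G V : Type*} [Group G] [NormedAddCommGroup V] [InnerProductSpace ℂ V]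

theorem waveletTransform_eq_inner (π : G →* (V ≃ₗᵢ[ℂ] V)) (f v : V) (g : G) :
    waveletTransform π f v g = inner ℂ (π g f) v := rfl

theorem waveletTransform_add (π : G →* (V ≃ₗᵢ[ℂ] V)) (f v w : V) :
    waveletTransform π f (v + w) = waveletTransform π f v + waveletTransform π f w :=
  funext fun _ => inner_add_right _ _ _

theorem waveletTransform_smul (π : G →* (V ≃ₗᵢ[ℂ] V)) (f : V) (a : ℂ) (v : V) :
    waveletTransform π f (a • v) = a • waveletTransform π f v :=
  funext fun _ => inner_smul_right _ _ _

theorem waveletTransform_zero (π : G →* (V ≃ₗᵢ[ℂ] V)) (f : V) : waveletTransform π f 0 = 0 :=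
  funext fun _ => inner_zero_right _

theorem waveletTransform_add_left (π : G →* (V ≃ₗᵢ[ℂ] V)) (f f' v : V) :
    waveletTransform π (f + f') v = waveletTransform π f v + waveletTransform π f' v :=
  funext fun _ => by simp [waveletTransform_eq_inner]

theorem waveletTransform_smul_left (π : G →* (V ≃ₗᵢ[ℂ] V)) (f : V) (a : ℂ) (v : V) :
    waveletTransform π (a • f) v = starRingEnd ℂ a • waveletTransform π f v :=
  funext fun g => by
    rw [waveletTransform_eq_inner, map_smul, inner_smul_left]
    rfl

theorem waveletTransform_zero_left (π : G →* (V ≃ₗᵢ[ℂ] V)) (v : V) :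
    waveletTransform π 0 v = 0 :=
  funext fun _ => by simp [waveletTransform_eq_inner]

theorem waveletTransform_map (π : G →* (V ≃ₗᵢ[ℂ] V)) (f v : V) (h g : G) :
    waveletTransform π f (π h v) g = waveletTransform π f v (h⁻¹ * g) := by
  rw [waveletTransform_eq_inner, waveletTransform_eq_inner, map_mul]
  refine .trans ?_ (inner_unitary_left π h⁻¹ (π g f) v).symm
  rw [inv_inv]

theorem IsStronglyContinuous.continuous_waveletTransform [TopologicalSpace G] {π : G →* (V ≃ₗᵢ[ℂ] V)}
    (hc : IsStronglyContinuous π) (f v : V) : Continuous (waveletTransform π f v) :=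
  (hc f).inner continuous_const

variable [MeasurableSpace G]

theorem ae_eq_waveletTransform_of_tendsto {μ : Measure G} {π : G →* (V ≃ₗᵢ[ℂ] V)} {f v : V}
    {u : ℕ → V} {F : ℕ → Lp ℂ 2 μ} {E : Lp ℂ 2 μ}
    (hF : ∀ n, F n =ᵐ[μ] waveletTransform π f (u n))
    (hu : Filter.Tendsto u Filter.atTop (nhds v)) (hE : Filter.Tendsto F Filter.atTop (nhds E)) :
    E =ᵐ[μ] waveletTransform π f v := by
  obtain ⟨φ, hφ, hlim⟩ := (tendstoInMeasure_of_tendsto_Lp hE).exists_seq_tendsto_ae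
  filter_upwards [hlim, ae_all_iff.2 hF] with g hg hFg
  refine tendsto_nhds_unique hg ?_
  simp only [hFg, waveletTransform_eq_inner]
  exact tendsto_const_nhds.inner (hu.comp hφ.tendsto_atTop)

/-- The graph of the densely defined operator `v ↦ waveletTransform π f v` from `V` to `L²`. -/
def waveletGraph (μ : Measure G) (π : G →* (V ≃ₗᵢ[ℂ] V)) (f : V) :
    Submodule ℂ (WithLp 2 (V × Lp ℂ 2 μ)) where
  carrier := {p | p.snd =ᵐ[μ] waveletTransform π f p.fst}
  add_mem' {p q} hp hq := by
    change _ =ᵐ[μ] _ at hp hq ⊢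
    rw [WithLp.add_fst, WithLp.add_snd, waveletTransform_add]
    exact (Lp.coeFn_add _ _).trans (hp.add hq)
  zero_mem' := by
    change _ =ᵐ[μ] _
    rw [WithLp.zero_fst, WithLp.zero_snd, waveletTransform_zero]
    exact Lp.coeFn_zero _ _ _
  smul_mem' a p hp := by
    change _ =ᵐ[μ] _ at hp ⊢
    rw [WithLp.smul_fst, WithLp.smul_snd, waveletTransform_smul]
    exact (Lp.coeFn_smul _ _).trans (hp.const_smul a)

theorem isClosed_waveletGraph (μ : Measure G) (π : G →* (V ≃ₗᵢ[ℂ] V)) (f : V) :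
    IsClosed (waveletGraph μ π f : Set (WithLp 2 (V × Lp ℂ 2 μ))) := by
  refine IsSeqClosed.isClosed fun p q hp hpq => ?_
  exact ae_eq_waveletTransform_of_tendsto hp
    (((WithLp.fstL 2 ℂ V (Lp ℂ 2 μ)).continuous.tendsto q).comp hpq)
    (((WithLp.sndL 2 ℂ V (Lp ℂ 2 μ)).continuous.tendsto q).comp hpq)

theorem exists_mem_waveletGraph {μ : Measure G} {π : G →* (V ≃ₗᵢ[ℂ] V)} {f v : V}
    (hv : MemLp (waveletTransform π f v) 2 μ) : ∃ p : waveletGraph μ π f, p.1.fst = v :=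
  ⟨⟨WithLp.toLp 2 (v, hv.toLp _), hv.coeFn_toLp⟩, rfl⟩

theorem memLp_of_mem_waveletGraph {μ : Measure G} {π : G →* (V ≃ₗᵢ[ℂ] V)} {f : V}
    (p : waveletGraph μ π f) : MemLp (waveletTransform π f p.1.fst) 2 μ :=
  (memLp_congr_ae p.2).1 (Lp.memLp _)

theorem inner_waveletGraph {μ : Measure G} {π : G →* (V ≃ₗᵢ[ℂ] V)} {f : V}
    (p q : waveletGraph μ π f) : inner ℂ p q = inner ℂ p.1.fst q.1.fst +
      ∫ g, inner ℂ (waveletTransform π f p.1.fst g) (waveletTransform π f q.1.fst g) ∂μ := by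
  rw [Submodule.coe_inner, WithLp.prod_inner_apply, L2.inner_def]
  congr 1
  refine integral_congr_ae ?_
  filter_upwards [p.2, q.2] with g hp hq
  exact congrArg₂ _ hp hq

/-- The wavelet transform as a linear map into `L²`. -/
noncomputable def waveletLM (μ : Measure G) (π : G →* (V ≃ₗᵢ[ℂ] V)) (f : V)
    (hf : ∀ v, MemLp (waveletTransform π f v) 2 μ) : V →ₗ[ℂ] Lp ℂ 2 μ where
  toFun v := (hf v).toLp _
  map_add' v w := by
    rw [← MemLp.toLp_add]
    exact MemLp.toLp_congr _ _ (by rw [waveletTransform_add])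
  map_smul' a v := by
    rw [RingHom.id_apply, ← MemLp.toLp_const_smul]
    exact MemLp.toLp_congr _ _ (by rw [waveletTransform_smul])

/-- The wavelet transform as a bounded operator into `L²`. -/
noncomputable def waveletCLM [CompleteSpace V] (μ : Measure G) (π : G →* (V ≃ₗᵢ[ℂ] V)) (f : V)
    (hf : ∀ v, MemLp (waveletTransform π f v) 2 μ) : V →L[ℂ] Lp ℂ 2 μ where
  toLinearMap := waveletLM μ π f hf
  cont := by
    refine (waveletLM μ π f hf).continuous_of_seq_closed_graph fun u x y hu hy => ?_
    refine Lp.ext ((ae_eq_waveletTransform_of_tendsto (fun n => ?_) hu hy).trans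
      (hf x).coeFn_toLp.symm)
    exact (hf (u n)).coeFn_toLp

theorem inner_waveletCLM [CompleteSpace V] {μ : Measure G} {π : G →* (V ≃ₗᵢ[ℂ] V)} {f f' : V}
    (hf : ∀ v, MemLp (waveletTransform π f v) 2 μ)
    (hf' : ∀ v, MemLp (waveletTransform π f' v) 2 μ) (v v' : V) :
    inner ℂ (waveletCLM μ π f hf v) (waveletCLM μ π f' hf' v') =
      ∫ g, inner ℂ (waveletTransform π f v g) (waveletTransform π f' v' g) ∂μ := by
  rw [L2.inner_def]
  refine integral_congr_ae ?_
  filter_upwards [(hf v).coeFn_toLp, (hf' v').coeFn_toLp] with g h h'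
  exact congrArg₂ _ h h'

/-- The vectors for which all wavelet transforms are square integrable. -/
def admissibleSubmodule (μ : Measure G) (π : G →* (V ≃ₗᵢ[ℂ] V)) : Submodule ℂ V where
  carrier := {f | ∀ v, MemLp (waveletTransform π f v) 2 μ}
  add_mem' hf hf' v := by
    rw [waveletTransform_add_left]
    exact (hf v).add (hf' v)
  zero_mem' v := by
    rw [waveletTransform_zero_left]
    exact MemLp.zero
  smul_mem' a f hf v := by
    rw [waveletTransform_smul_left]
    exact (hf v).const_smul _

theorem integrable_inner_waveletTransform {μ : Measure G} {π : G →* (V ≃ₗᵢ[ℂ] V)}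
    (f f' : admissibleSubmodule μ π) (v v' : V) :
    Integrable (fun g => inner ℂ (waveletTransform π (f' : V) v' g)
      (waveletTransform π (f : V) v g)) μ := by
  have := (f.2 v).integrable_mul (f'.2 v').star
  exact this

/-- The form `(f', f) ↦ ∫ ⟨v, π(g) f⟩ conj ⟨v, π(g) f'⟩ dg` for a fixed vector `v`. -/
noncomputable def waveletForm (μ : Measure G) (π : G →* (V ≃ₗᵢ[ℂ] V)) (v : V) :
    admissibleSubmodule μ π →ₗ[ℂ] admissibleSubmodule μ π →ₛₗ[starRingEnd ℂ] ℂ :=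
  LinearMap.mk₂'ₛₗ (RingHom.id ℂ) (starRingEnd ℂ)
    (fun f' f => ∫ g, inner ℂ (waveletTransform π (f' : V) v g)
      (waveletTransform π (f : V) v g) ∂μ)
    (fun f₁ f₂ f => by
      rw [← integral_add (integrable_inner_waveletTransform _ _ _ _)
        (integrable_inner_waveletTransform _ _ _ _)]
      simp only [Submodule.coe_add, waveletTransform_add_left, Pi.add_apply, inner_add_left])
    (fun a f' f => by
      simp only [Submodule.coe_smul, waveletTransform_smul_left, Pi.smul_apply, inner_smul_left,
        RingHom.id_apply, Complex.conj_conj]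
      exact integral_const_mul _ _)
    (fun f' f₁ f₂ => by
      rw [← integral_add (integrable_inner_waveletTransform _ _ _ _)
        (integrable_inner_waveletTransform _ _ _ _)]
      simp only [Submodule.coe_add, waveletTransform_add_left, Pi.add_apply, inner_add_right])
    (fun a f' f => by
      simp only [Submodule.coe_smul, waveletTransform_smul_left, Pi.smul_apply, inner_smul_right]
      exact integral_const_mul _ _)

variable [TopologicalSpace G] [BorelSpace G]

theorem IsStronglyContinuous.memLp_waveletTransform_iff {μ : Measure G}
    {π : G →* (V ≃ₗᵢ[ℂ] V)} (hc : IsStronglyContinuous π) (f v : V) :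
    MemLp (waveletTransform π f v) 2 μ ↔ ∫⁻ g, ‖waveletTransform π f v g‖ₑ ^ 2 ∂μ < ⊤ := by
  rw [MemLp, and_iff_right (hc.continuous_waveletTransform f v).measurable.aestronglyMeasurable,
    eLpNorm_lt_top_iff_lintegral_rpow_enorm_lt_top two_ne_zero ENNReal.ofNat_ne_top]
  simp

theorem IsStronglyContinuous.lintegral_waveletTransform_self_pos {μ : Measure G}
    [μ.IsOpenPosMeasure] {π : G →* (V ≃ₗᵢ[ℂ] V)} (hc : IsStronglyContinuous π) {f : V}
    (hf : f ≠ 0) : 0 < ∫⁻ g, ‖waveletTransform π f f g‖ₑ ^ 2 ∂μ := by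
  have hcont : Continuous fun g => ‖waveletTransform π f f g‖ₑ ^ 2 :=
    (hc.continuous_waveletTransform f f).enorm |> (ENNReal.continuous_pow 2).comp
  rw [lintegral_pos_iff_support hcont.measurable]
  refine (hcont.isOpen_support).measure_pos μ ⟨1, ?_⟩
  simp [waveletTransform_eq_inner, hf]

variable [IsTopologicalGroup G]

theorem integral_inner_waveletTransform_map (μ : Measure G) [μ.IsMulLeftInvariant]
    (π : G →* (V ≃ₗᵢ[ℂ] V)) (f f' v w : V) (h : G) :
    ∫ g, inner ℂ (waveletTransform π f (π h v) g) (waveletTransform π f' w g) ∂μ =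
      ∫ g, inner ℂ (waveletTransform π f v g) (waveletTransform π f' (π h⁻¹ w) g) ∂μ := by
  rw [← integral_mul_left_eq_self _ h]
  simp only [waveletTransform_map, inv_inv, inv_mul_cancel_left]

theorem memLp_waveletTransform_map {μ : Measure G} [μ.IsMulLeftInvariant]
    {π : G →* (V ≃ₗᵢ[ℂ] V)} {f v : V} (hv : MemLp (waveletTransform π f v) 2 μ) (h : G) :
    MemLp (waveletTransform π f (π h v)) 2 μ := by
  have := hv.comp_measurePreserving (measurePreserving_mul_left μ h⁻¹)
  convert this using 1
  exact funext (waveletTransform_map π f v h)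

variable [CompleteSpace V]

/-- If some nonzero vector has a square integrable wavelet transform, then all vectors do. -/
theorem IsTopIrreducible.memLp_waveletTransform {μ : Measure G} [μ.IsMulLeftInvariant]
    {π : G →* (V ≃ₗᵢ[ℂ] V)} (hπ : IsTopIrreducible π) {f w : V} (hw0 : w ≠ 0)
    (hw : MemLp (waveletTransform π f w) 2 μ) (v : V) :
    MemLp (waveletTransform π f v) 2 μ := by
  have : CompleteSpace (waveletGraph μ π f) := (isClosed_waveletGraph μ π f).completeSpace_coe
  let j : waveletGraph μ π f →L[ℂ] V :=
    (WithLp.fstL 2 ℂ V (Lp ℂ 2 μ)).comp (waveletGraph μ π f).subtypeL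
  have hj : ∀ p, j p = p.1.fst := fun _ => rfl
  let j' := ContinuousLinearMap.adjoint j
  have hcomm : ∀ h x, (j.comp j') (π h x) = π h ((j.comp j') x) := by
    intro h x
    obtain ⟨q, hq⟩ := exists_mem_waveletGraph
      (memLp_waveletTransform_map (memLp_of_mem_waveletGraph (j' x)) h)
    suffices hs : j' (π h x) = q by
      change j (j' (π h x)) = π h (j (j' x))
      rw [hs, hj, hq, hj]
    refine ext_inner_right ℂ fun r => ?_
    obtain ⟨r', hr'⟩ := exists_mem_waveletGraph
      (memLp_waveletTransform_map (memLp_of_mem_waveletGraph r) h⁻¹)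
    have h1 : inner ℂ (j' (π h x)) r = inner ℂ (π h x) r.1.fst :=
      ContinuousLinearMap.adjoint_inner_left j r _
    have h2 : inner ℂ (j' x) r' = inner ℂ x r'.1.fst :=
      ContinuousLinearMap.adjoint_inner_left j r' _
    rw [h1, inner_unitary_left, ← hr', ← h2, inner_waveletGraph, inner_waveletGraph, hq, hr',
      integral_inner_waveletTransform_map, inner_unitary_left]
  obtain ⟨a, ha⟩ := hπ.exists_eq_smul hcomm
  have hax : ∀ x, j (j' x) = a • x := fun x => congrArg (fun A : V →L[ℂ] V => A x) ha
  have ha0 : a ≠ 0 := by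
    rintro rfl
    obtain ⟨p, rfl⟩ := exists_mem_waveletGraph hw
    apply hw0
    have h0 : j' (j p) = 0 := by
      refine (inner_self_eq_zero (𝕜 := ℂ)).1 ?_
      refine (ContinuousLinearMap.adjoint_inner_left j _ _).trans ?_
      rw [hax, zero_smul, inner_zero_right]
    refine (inner_self_eq_zero (𝕜 := ℂ)).1 ?_
    refine (ContinuousLinearMap.adjoint_inner_left j p (j p)).symm.trans ?_
    change inner ℂ (j' (j p)) p = 0
    rw [h0, inner_zero_left]
  have := memLp_of_mem_waveletGraph (j' (a⁻¹ • v))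
  rwa [← hj, hax, smul_inv_smul₀ ha0] at this

theorem IsTopIrreducible.exists_integral_inner_waveletTransform {μ : Measure G}
    [μ.IsMulLeftInvariant] {π : G →* (V ≃ₗᵢ[ℂ] V)} (hπ : IsTopIrreducible π) {f f' : V}
    (hf : ∀ v, MemLp (waveletTransform π f v) 2 μ)
    (hf' : ∀ v, MemLp (waveletTransform π f' v) 2 μ) :
    ∃ a : ℂ, ∀ v v', ∫ g, inner ℂ (waveletTransform π f' v' g) (waveletTransform π f v g) ∂μ =
      a * inner ℂ v' v := by
  let W := waveletCLM μ π f hf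
  let W' := waveletCLM μ π f' hf'
  have hWW : ∀ v v', inner ℂ v' ((ContinuousLinearMap.adjoint W').comp W v) =
      ∫ g, inner ℂ (waveletTransform π f' v' g) (waveletTransform π f v g) ∂μ := fun v v' => by
    rw [ContinuousLinearMap.comp_apply, ContinuousLinearMap.adjoint_inner_right, inner_waveletCLM]
  obtain ⟨a, ha⟩ := hπ.exists_eq_smul (T := (ContinuousLinearMap.adjoint W').comp W) fun h x => by
    refine ext_inner_left ℂ fun y => ?_
    obtain ⟨z, rfl⟩ := (π h).surjective y
    rw [(π h).inner_map_map, hWW, hWW, integral_inner_waveletTransform_map, map_inv]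
    exact congrArg (fun y => ∫ g, inner ℂ (waveletTransform π f' z g) (waveletTransform π f y g) ∂μ)
      ((π h).symm_apply_apply x)
  refine ⟨a, fun v v' => ?_⟩
  rw [← hWW, ha, smul_apply, inner_smul_right]
  rfl

theorem IsTopIrreducible.forall_memLp_iff {μ : Measure G} [μ.IsMulLeftInvariant]
    [μ.IsOpenPosMeasure] {π : G →* (V ≃ₗᵢ[ℂ] V)} (hπ : IsTopIrreducible π)
    (hc : IsStronglyContinuous π) (f : V) :
    (∀ v, MemLp (waveletTransform π f v) 2 μ) ↔ f = 0 ∨ IsAdmissible π μ f := by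
  constructor
  · intro h
    by_cases hf : f = 0
    · exact Or.inl hf
    · exact Or.inr ⟨hc.lintegral_waveletTransform_self_pos hf,
        (hc.memLp_waveletTransform_iff f f).1 (h f)⟩
  · rintro (rfl | h) v
    · rw [waveletTransform_zero_left]
      exact MemLp.zero
    · refine hπ.memLp_waveletTransform (w := f) ?_ ((hc.memLp_waveletTransform_iff f f).2 h.2) v
      rintro rfl
      simpa [waveletTransform_zero_left] using h.1

end WaveletTransform

theorem mainTheorem5
    {G : Type*} [Group G] [TopologicalSpace G] [IsTopologicalGroup G] [LocallyCompactSpace G]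
    [MeasurableSpace G] [BorelSpace G]
    {V : Type*} [NormedAddCommGroup V] [InnerProductSpace ℂ V] [CompleteSpace V]
    (μ : Measure G) [μ.IsHaarMeasure]
    (π : G →* (V ≃ₗᵢ[ℂ] V)) (hπ : IsSquareIntegrableRep π μ) :
    ∃ A : Submodule ℂ V, (∀ f : V, f ∈ A ↔ f = 0 ∨ IsAdmissible π μ f) ∧
      ∃ c : A →ₗ[ℂ] A →ₛₗ[starRingEnd ℂ] ℂ, ∀ f f' : A, ∀ v v' : V,
        Integrable (fun g : G =>
          scalar v (π g f) * (starRingEnd ℂ) (scalar v' (π g f'))) μ ∧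
        ∫ g, scalar v (π g f) * (starRingEnd ℂ) (scalar v' (π g f')) ∂μ
          = c f' f * scalar v v' := by
  have := hπ.irreducible.1
  obtain ⟨e, he⟩ := exists_norm_eq V zero_le_one
  refine ⟨admissibleSubmodule μ π, hπ.irreducible.forall_memLp_iff hπ.continuous,
    waveletForm μ π e, fun f f' v v' => ⟨integrable_inner_waveletTransform f f' v v', ?_⟩⟩
  obtain ⟨a, ha⟩ := hπ.irreducible.exists_integral_inner_waveletTransform f.2 f'.2
  have hform : waveletForm μ π e f' f = a := by
    refine (ha e e).trans ?_
    rw [inner_self_eq_norm_sq_to_K, he]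
    simp
  rw [hform]
  exact ha v v'
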